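/- Let $G$ be a connected undirected simple graph with finite node set $\mathcal V$, $|\mathcal V|=n$, and edge set $\mathcal E$, $|\mathcal E|=m$. Orient its edges arbitrarily, let $B\in\{-1,0,1\}^{n\times m}$ be the incidence matrix with $(B^\top x)_e=x_i-x_j$ for an edge $e=\{i,j\}$ oriented from $j$ to $i$, and write $y_e=y_{ij}$ for the corresponding coordinates of $y\in\mathbb R^m$. Let $\Sigma$ be a cycle basis, i.e. a set of simple cycles whose cycle vectors (entry $+1$, $-1$ or $0$ at an edge that is traversed along its orientation, against it, or not at all) form a basis of the space spanned by all such vectors; let $C_\Sigma$ be the matrix with these cycle vectors as rows. Let $a_e>0$ $(e\in\mathcal E)$, $d_i>0$, $p^*_i\in\mathbb R$ $(i\in\mathcal V)$, $\omega^*\in\mathbb R$, and put $\mathcal A=\mathrm{diag}(a)$, $D=\mathrm{diag}(d)$, $p=p^*+\omega^*d$, $\omega_{\rm syn}=\omega^*+\sum_ip_i^*/\sum_id_i$. For $\theta$ in the torus $\mathbb T^n$, $\mathbb T=\mathbb R/2\pi\mathbb Z$, let $f(\theta)=p-B\mathcal A\sin(B^\top\theta)$ and $V_\infty(\theta)=\|D^{-1}f(\theta)-\omega_{\rm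 syn}\mathbf 1_n\|_\infty$. For $\alpha,\beta\in\mathbb T$ let $|\alpha-\beta|\in[0,\pi]$ be the geodesic distance and $d_{\rm cc}(\alpha,\beta)\in[-\pi,\pi)$ the representative of $\beta-\alpha$. The winding number of $\theta$ along a cycle $\sigma=(i_1,\dots,i_k,i_{k+1}=i_1)$ is $w_\sigma(\theta)=\frac1{2\pi}\sum_{l=1}^k d_{\rm cc}(\theta_{i_l},\theta_{i_{l+1}})$, and $w_\Sigma(\theta)=(w_\sigma(\theta))_{\sigma\in\Sigma}$. Let $u\in w_\Sigma(\mathbb T^n)$, $\Omega_u=\{\theta: w_\Sigma(\theta)=u\}$, $\gamma\in(0,\frac\pi2]^m$, $\Delta(\gamma)=\{\theta: |\theta_i-\theta_j|<\gamma_{ij}\ \forall\{i,j\}\in\mathcal E\}$ and $S=\Omega_u\cap\Delta(\gamma)$. A vector $v\in\mathbb R^n$ is said to point outward from $S$ at $\theta\in\partial S$ if it does not point strictly into $S$, i.e. if there are $t_k\downarrow0$ and $v_k\to v$ with $\theta+t_kv_k\notin S$ for all $k$. For every edge $e$ let $\mathcal P_e\subset[-\gamma_e,\gamma_e]\times\mathbb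 R$ be a polytope (the convex hull of finitely many points) that contains $\{(t,\sin t): |t|\le\gamma_e\}$. Define three values in $[0,+\infty]$, each being the infimum of an optimization problem, with value $+\infty$ if it is infeasible: * $V^*_\infty(\partial S)$ is the infimum of $V_\infty(\theta)$ over all $\theta\in\partial S$ such that $D^{-1}f(\theta)$ points outward from $S$ at $\theta$. * $V^{(1)}_\infty(\gamma)$ is the infimum of $\|D^{-1}f-\omega_{\rm syn}\mathbf 1_n\|_\infty$ over all $y,\eta\in\mathbb R^m$, $f\in\mathbb R^n$ with $f=p-B\mathcal A\eta$, $\eta=\sin(y)$, $|y|\le\gamma$, $C_\Sigma y=2\pi u$, and with $y_{ij}=z\gamma_{ij}$ and $z(d_i^{-1}f_i-d_j^{-1}f_j)\ge0$ for some $z\in\{-1,1\}$ and some $\{i,j\}\in\mathcal E$. * $V^{(2)}_\infty(\gamma)=\min_{z,e}V^{(2)}_\infty(\gamma,z,e)$ over $z\in\{-1,1\}$ and $e\in\mathcal E$ $(+\infty$ if $\mathcal E=\emptyset)$, where, for $e=\{i,j\}$, $V^{(2)}_\infty(\gamma,z,e)$ is the infimum of $\|D^{-1}f-\omega_{\rm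 syn}\mathbf 1_n\|_\infty$ over all $y,\eta\in\mathbb R^m$, $f\in\mathbb R^n$ with $f=p-B\mathcal A\eta$, $(y_{e'},\eta_{e'})\in\mathcal P_{e'}$ for all $e'\in\mathcal E$, $C_\Sigma y=2\pi u$, $y_e=z\gamma_e$ and $z(d_i^{-1}f_i-d_j^{-1}f_j)\ge0$. Then $V^{(2)}_\infty(\gamma)\le V^{(1)}_\infty(\gamma)$ and, if $S\ne\emptyset$, $V^{(1)}_\infty(\gamma)=V^*_\infty(\partial S)$. -/

import Mathlib

open Filter Topology Matrix

noncomputable section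

namespace DroopGrid

/-! ### Angles and the torus -/

/-- The torus of states: one point of the circle `ℝ / 2πℤ` for every node. -/
abbrev Torus (V : Type*) : Type _ := V → Real.Angle

/-- Geodesic distance on the circle, with values in `[0, π]`. -/
def geoDist (α β : Real.Angle) : ℝ := |(α - β).toReal|

/-- Counterclockwise distance from `α` to `β`: the representative of `β - α` in `[-π, π)`
(`Real.Angle.toReal` takes values in `(-π, π]`, whence the two sign changes). -/
def dcc (α β : Real.Angle) : ℝ := -(α - β).toReal

/-- `v` points outward from `S` at `θ`: arbitrarily short displacements of `θ`, in directions
arbitrarily close to `v`, lead to points outside `S`. Equivalently, `v` lies in the Bouligand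
tangent cone of the complement of `S` at `θ`, i.e. `v` does not point strictly into `S`.
(Directions tangent to the boundary count as outward.) -/
def PointsOutward {V : Type*} (S : Set (Torus V)) (θ : Torus V) (v : V → ℝ) : Prop :=
  ∃ᶠ q : ℝ × (V → ℝ) in 𝓝[>] (0 : ℝ) ×ˢ 𝓝 v,
    (fun i => θ i + ((q.1 * q.2 i : ℝ) : Real.Angle)) ∉ S

/-! ### Graphs, cycles, winding vectors -/

/-- An orientation of the edges of a simple graph. -/
structure Orientation {V : Type*} (G : SimpleGraph V) where
  /-- the start of an oriented edge -/
  tail : G.edgeSet → V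
  /-- the end of an oriented edge -/
  head : G.edgeSet → V
  ends : ∀ e, s(tail e, head e) = (e : Sym2 V)

section Graph

variable {V : Type*} [DecidableEq V] {G : SimpleGraph V}

/-- The oriented node-edge incidence matrix: `+1` at the head and `-1` at the tail, so that
`(Bᵀ x) e = x (head e) - x (tail e)`. -/
def incidence (o : Orientation G) : Matrix V G.edgeSet ℝ := fun v e =>
  if v = o.head e then 1 else if v = o.tail e then -1 else 0

/-- The cycle vector of a cycle `c`: `+1` on the edges traversed from tail to head, `-1` on the
edges traversed from head to tail, `0` on all other edges. -/
def cycleVector (o : Orientation G) {x : V} (c : G.Walk x x) : G.edgeSet → ℝ := fun e =>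
  if ∃ δ ∈ c.darts, δ.fst = o.tail e ∧ δ.snd = o.head e then 1
  else if ∃ δ ∈ c.darts, δ.fst = o.head e ∧ δ.snd = o.tail e then -1
  else 0

/-- The cycle space: the span of the cycle vectors of all simple cycles. -/
def cycleSpace (o : Orientation G) : Submodule ℝ (G.edgeSet → ℝ) :=
  Submodule.span ℝ {v | ∃ (x : V) (c : G.Walk x x), c.IsCycle ∧ v = cycleVector o c}

/-- A cycle basis: a family of simple cycles whose cycle vectors form a basis of the cycle
space. -/
structure CycleBasis (o : Orientation G) (ι : Type*) where
  base : ι → V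
  cycle : ∀ k, G.Walk (base k) (base k)
  isCycle : ∀ k, (cycle k).IsCycle
  linearIndependent : LinearIndependent ℝ fun k => cycleVector o (cycle k)
  span_eq : Submodule.span ℝ (Set.range fun k => cycleVector o (cycle k)) = cycleSpace o

/-- The cycle-edge incidence matrix of a cycle basis. -/
def CycleBasis.matrix {o : Orientation G} {ι : Type*} (Sig : CycleBasis o ι) :
    Matrix ι G.edgeSet ℝ := fun k e => cycleVector o (Sig.cycle k) e

/-- The winding number of `θ` along a closed walk: `1 / 2π` times the sum of the
counterclockwise distances between consecutive nodes. -/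
def windingNumber (θ : Torus V) {x : V} (c : G.Walk x x) : ℝ :=
  1 / (2 * Real.pi) * (c.darts.map fun δ => dcc (θ δ.fst) (θ δ.snd)).sum

/-- The winding vector of `θ` along a cycle basis. -/
def windingVector {o : Orientation G} {ι : Type*} (Sig : CycleBasis o ι) (θ : Torus V) :
    ι → ℝ := fun k => windingNumber θ (Sig.cycle k)

/-- The winding cell of a winding vector `u`. -/
def windingCell {o : Orientation G} {ι : Type*} (Sig : CycleBasis o ι) (u : ι → ℝ) :
    Set (Torus V) := {θ | windingVector Sig θ = u}

/-- The phase-cohesive set: the distance across each edge `e` is less than `γ e`. -/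
def cohesiveSet (o : Orientation G) (γ : G.edgeSet → ℝ) : Set (Torus V) :=
  {θ | ∀ e, geoDist (θ (o.head e)) (θ (o.tail e)) < γ e}

end Graph

/-! ### The Kuramoto vector field and the frequency deviation -/

/-- Parameters of the grid: edge weights `a > 0`, droop coefficients `d > 0`, nominal power
injections `pNom` and rated frequency `ωRated`. -/
structure Params {V : Type*} (G : SimpleGraph V) where
  a : G.edgeSet → ℝ
  a_pos : ∀ e, 0 < a e
  d : V → ℝ
  d_pos : ∀ i, 0 < d i
  pNom : V → ℝ
  ωRated : ℝ

section Dynamics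

variable {V : Type*} [Fintype V] [DecidableEq V] {G : SimpleGraph V} [DecidableRel G.Adj]

/-- `p = p* + ω* d`. -/
def Params.p (P : Params G) : V → ℝ := fun i => P.pNom i + P.ωRated * P.d i

/-- The synchronous frequency `ω* + p*_sum / d_sum`. -/
def Params.ωSyn (P : Params G) : ℝ := P.ωRated + (∑ i, P.pNom i) / ∑ i, P.d i

/-- The net injection `p - B 𝒜 η`, where `𝒜` is the diagonal matrix of the edge weights. -/
def netInjection (o : Orientation G) (P : Params G) (η : G.edgeSet → ℝ) : V → ℝ :=
  P.p - incidence o *ᵥ (Matrix.diagonal P.a *ᵥ η)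

/-- The vector field `f(θ) = p - B 𝒜 sin(Bᵀ θ)` of the Kuramoto model `D θ' = f(θ)`. -/
def vectorField (o : Orientation G) (P : Params G) (θ : Torus V) : V → ℝ :=
  netInjection o P fun e => (θ (o.head e) - θ (o.tail e)).sin

/-- `D⁻¹ f`. -/
def Params.freq (P : Params G) (f : V → ℝ) : V → ℝ := fun i => (P.d i)⁻¹ * f i

/-- `‖D⁻¹ f - ω_syn 1‖_∞` (the norm of `V → ℝ` is the sup norm). -/
def Params.deviation (P : Params G) (f : V → ℝ) : ℝ := ‖P.freq f - fun _ => P.ωSyn‖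

/-- The maximum frequency deviation `V_∞(θ)`. -/
def maxFreqDeviation (o : Orientation G) (P : Params G) (θ : Torus V) : ℝ :=
  P.deviation (vectorField o P θ)

/-! ### The three optimization problems

The value of each problem is an extended real number; it is `⊤ = +∞` if the problem is
infeasible. -/

/-- `V*_∞(∂S)`: the least value of `V_∞(θ)` over the points `θ` of the boundary of `S` at which
`D⁻¹ f(θ)` points outward from `S`. -/
def minMaxDeviation (o : Orientation G) (P : Params G) (S : Set (Torus V)) : EReal :=
  ⨅ θ : {θ : Torus V // θ ∈ frontier S ∧ PointsOutward S θ (P.freq (vectorField o P θ))},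
    (maxFreqDeviation o P θ.1 : EReal)

/-- The condition that `y` lies on the face `y_e = z γ_e`, and that
`z (d_i⁻¹ f_i - d_j⁻¹ f_j) ≥ 0` across the edge `e`, where `y_e` stands for `θ_i - θ_j`. -/
def OutwardFace (o : Orientation G) (P : Params G) (γ : G.edgeSet → ℝ) (z : ℝ) (e : G.edgeSet)
    (y : G.edgeSet → ℝ) (f : V → ℝ) : Prop :=
  y e = z * γ e ∧ 0 ≤ z * ((P.d (o.head e))⁻¹ * f (o.head e) - (P.d (o.tail e))⁻¹ * f (o.tail e))

/-- The constraints of the real-variable transcription, on the variables `(y, η, f)`. -/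
structure TranscriptionFeasible {o : Orientation G} {ι : Type*} (Sig : CycleBasis o ι)
    (P : Params G) (u : ι → ℝ) (γ : G.edgeSet → ℝ)
    (x : (G.edgeSet → ℝ) × (G.edgeSet → ℝ) × (V → ℝ)) : Prop where
  f_eq : x.2.2 = netInjection o P x.2.1
  η_eq : ∀ e, x.2.1 e = Real.sin (x.1 e)
  y_le : ∀ e, |x.1 e| ≤ γ e
  winding : Sig.matrix *ᵥ x.1 = (2 * Real.pi) • u
  outward : ∃ z ∈ ({-1, 1} : Set ℝ), ∃ e, OutwardFace o P γ z e x.1 x.2.2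

/-- `V^(1)_∞(γ)`: the value of the real-variable transcription. -/
def transcriptionValue {o : Orientation G} {ι : Type*} (Sig : CycleBasis o ι)
    (P : Params G) (u : ι → ℝ) (γ : G.edgeSet → ℝ) : EReal :=
  ⨅ x : {x // TranscriptionFeasible Sig P u γ x}, (P.deviation x.1.2.2 : EReal)

/-- `Q` is an admissible polytope relaxation of the sine graph on `[-g, g]`: the convex hull of
finitely many points, lying over `[-g, g]` and containing the graph of the sine over `[-g, g]`. -/
structure IsSineRelaxation (g : ℝ) (Q : Set (ℝ × ℝ)) : Prop where
  polytope : ∃ F : Set (ℝ × ℝ), F.Finite ∧ Q = convexHull ℝ F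
  subset_strip : Q ⊆ Set.Icc (-g) g ×ˢ Set.univ
  graph_subset : ∀ t ∈ Set.Icc (-g) g, (t, Real.sin t) ∈ Q

/-- The constraints of the relaxed problem for the face `(z, e)`, on the variables
`(y, η, f)`. -/
structure RelaxationFeasible {o : Orientation G} {ι : Type*} (Sig : CycleBasis o ι)
    (P : Params G) (u : ι → ℝ) (γ : G.edgeSet → ℝ) (Q : G.edgeSet → Set (ℝ × ℝ))
    (z : ℝ) (e : G.edgeSet)
    (x : (G.edgeSet → ℝ) × (G.edgeSet → ℝ) × (V → ℝ)) : Prop where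
  f_eq : x.2.2 = netInjection o P x.2.1
  mem_polytope : ∀ e', (x.1 e', x.2.1 e') ∈ Q e'
  winding : Sig.matrix *ᵥ x.1 = (2 * Real.pi) • u
  outward : OutwardFace o P γ z e x.1 x.2.2

/-- `V^(2)_∞(γ, z, e)`: the value of the relaxed linear program for the face `(z, e)`. -/
def faceRelaxationValue {o : Orientation G} {ι : Type*} (Sig : CycleBasis o ι)
    (P : Params G) (u : ι → ℝ) (γ : G.edgeSet → ℝ) (Q : G.edgeSet → Set (ℝ × ℝ))
    (z : ℝ) (e : G.edgeSet) : EReal :=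
  ⨅ x : {x // RelaxationFeasible Sig P u γ Q z e x}, (P.deviation x.1.2.2 : EReal)

/-- `V^(2)_∞(γ) = min_{z, e} V^(2)_∞(γ, z, e)`. -/
def relaxationValue {o : Orientation G} {ι : Type*} (Sig : CycleBasis o ι)
    (P : Params G) (u : ι → ℝ) (γ : G.edgeSet → ℝ) (Q : G.edgeSet → Set (ℝ × ℝ)) : EReal :=
  ⨅ z ∈ ({-1, 1} : Set ℝ), ⨅ e, faceRelaxationValue Sig P u γ Q z e

end Dynamics

end DroopGrid

end

/-!
The comparison takes place in the coordinates `y = edgeDiff o θ`, the representatives in `(-π, π]`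
of the angle differences `θ_i - θ_j` across the edges. As long as no coordinate reaches `±π`, the
winding number along a cycle is, up to the factor `2π`, the pairing of its cycle vector with `y`
(`matrix_mulVec_edgeDiff`), and a displacement of `θ` by `x : V → ℝ` adds the potential difference
`Bᵀ x` to `y` (`edgeDiff_shift`). Since `γ ≤ π / 2 < π`, the set `S` is therefore given by the open
box `|y_e| < γ_e` and the affine condition `C_Σ y = 2π u` (`mem_cell_iff`), and states in its
closure satisfy the same affine condition and the closed box constraints (`of_mem_closure_cell`).

Conversely, an edge vector in the kernel of `C_Σ` sums to zero along every simple cycle, hence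
along every closed walk because loops can be cut out one at a time (`walkFlow_bypass`), so on a
connected graph it is a potential difference. If `S` has a point `θ₀`, every `y` satisfying the
closed box constraints and `C_Σ y = 2π u` is thus reached from `θ₀` by a displacement, and the
segment from `θ₀` to the state so obtained stays in `S` up to its end point
(`exists_mem_closure_cell`).

It remains to match the outward conditions. A velocity that strictly shortens every edge at its
bound `|y_e| = γ_e` leads into `S` for all short times, and so do all nearby velocities; a velocity
`v` with `z (v_i - v_j) ≥ 0` on a face `y_e = z γ_e` leaves `S` at once
(`exists_face_of_pointsOutward`, `pointsOutward_of_face`). So the transcription and the problem on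
`∂S` have the same attainable values. The relaxed problem merely enlarges the feasible set.
-/

namespace DroopGrid

open SimpleGraph

/-! ### Edge vectors summed along walks, and potentials -/

section Flow

variable {V : Type*} {G : SimpleGraph V}

/-- The potential difference `Bᵀ x` across every edge. -/
def gradient (o : Orientation G) (x : V → ℝ) : G.edgeSet → ℝ :=
  fun e => x (o.head e) - x (o.tail e)

theorem Orientation.dart_cases (o : Orientation G) (δ : G.Dart) :
    (δ.fst = o.tail ⟨δ.edge, δ.edge_mem⟩ ∧ δ.snd = o.head ⟨δ.edge, δ.edge_mem⟩) ∨
      (δ.fst ≠ o.tail ⟨δ.edge, δ.edge_mem⟩ ∧ δ.fst = o.head ⟨δ.edge, δ.edge_mem⟩ ∧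
        δ.snd = o.tail ⟨δ.edge, δ.edge_mem⟩) := by
  have h : s(o.tail ⟨δ.edge, δ.edge_mem⟩, o.head ⟨δ.edge, δ.edge_mem⟩) = s(δ.fst, δ.snd) :=
    o.ends ⟨δ.edge, δ.edge_mem⟩
  rcases Sym2.eq_iff.1 h with ⟨h, h'⟩ | ⟨h, h'⟩
  · exact Or.inl ⟨h.symm, h'.symm⟩
  · refine Or.inr ⟨?_, h'.symm, h.symm⟩
    rw [h]
    exact δ.fst_ne_snd

variable [DecidableEq V]

/-- The value of an edge vector `y` along a dart: `y e` if the dart runs along the orientation of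
its edge `e`, and `-y e` if it runs against it. -/
def dartFlow (o : Orientation G) (y : G.edgeSet → ℝ) (δ : G.Dart) : ℝ :=
  if δ.fst = o.tail ⟨δ.edge, δ.edge_mem⟩ then y ⟨δ.edge, δ.edge_mem⟩
  else -y ⟨δ.edge, δ.edge_mem⟩

/-- The sum of an edge vector along a walk, with signs given by the orientation. -/
def walkFlow (o : Orientation G) (y : G.edgeSet → ℝ) {a b : V} (w : G.Walk a b) : ℝ :=
  (w.darts.map (dartFlow o y)).sum

theorem dartFlow_symm (o : Orientation G) (y : G.edgeSet → ℝ) (δ : G.Dart) :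
    dartFlow o y δ.symm = -dartFlow o y δ := by
  have he : (⟨δ.symm.edge, δ.symm.edge_mem⟩ : G.edgeSet) = ⟨δ.edge, δ.edge_mem⟩ :=
    Subtype.ext δ.edge_symm
  have hne := δ.fst_ne_snd
  unfold dartFlow
  rw [he]
  rcases o.dart_cases δ with ⟨h1, h2⟩ | ⟨h0, h1, h2⟩
  · have : δ.symm.fst ≠ o.tail ⟨δ.edge, δ.edge_mem⟩ := by
      rw [← h1]; exact hne.symm
    rw [if_neg this, if_pos h1]
  · have : δ.symm.fst = o.tail ⟨δ.edge, δ.edge_mem⟩ := h2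
    rw [if_pos this, if_neg h0, neg_neg]

theorem dartFlow_gradient (o : Orientation G) (x : V → ℝ) (δ : G.Dart) :
    dartFlow o (gradient o x) δ = x δ.snd - x δ.fst := by
  unfold dartFlow gradient
  rcases o.dart_cases δ with ⟨h1, h2⟩ | ⟨h0, h1, h2⟩
  · rw [if_pos h1, ← h1, ← h2]
  · rw [if_neg h0, ← h1, ← h2, neg_sub]

@[simp]
theorem walkFlow_nil (o : Orientation G) (y : G.edgeSet → ℝ) (a : V) :
    walkFlow o y (Walk.nil : G.Walk a a) = 0 := by
  simp [walkFlow]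

@[simp]
theorem walkFlow_cons (o : Orientation G) (y : G.edgeSet → ℝ) {a b c : V} (h : G.Adj a b)
    (w : G.Walk b c) :
    walkFlow o y (Walk.cons h w) = dartFlow o y ⟨(a, b), h⟩ + walkFlow o y w := by
  simp [walkFlow]

@[simp]
theorem walkFlow_append (o : Orientation G) (y : G.edgeSet → ℝ) {a b c : V}
    (w : G.Walk a b) (w' : G.Walk b c) :
    walkFlow o y (w.append w') = walkFlow o y w + walkFlow o y w' := by
  simp [walkFlow]

@[simp]
theorem walkFlow_reverse (o : Orientation G) (y : G.edgeSet → ℝ) {a b : V} (w : G.Walk a b) :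
    walkFlow o y w.reverse = -walkFlow o y w := by
  induction w with
  | nil => simp
  | cons h w ih =>
    have := dartFlow_symm o y ⟨(_, _), h⟩
    simp only [Dart.symm_mk, Prod.swap_prod_mk] at this
    simp only [Walk.reverse_cons, walkFlow_append, ih, walkFlow_cons, walkFlow_nil, this]
    ring

theorem walkFlow_gradient (o : Orientation G) (x : V → ℝ) {a b : V} (w : G.Walk a b) :
    walkFlow o (gradient o x) w = x b - x a := by
  induction w with
  | nil => simp
  | cons h w ih => rw [walkFlow_cons, ih, dartFlow_gradient]; ring

/-- A cycle traverses each of its edges exactly once, so pairing with its cycle vector is summing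
along the cycle. -/
theorem cycleVector_dotProduct [Fintype G.edgeSet] (o : Orientation G) (y : G.edgeSet → ℝ) {a : V}
    {c : G.Walk a a} (hc : c.IsCycle) :
    cycleVector o c ⬝ᵥ y = walkFlow o y c := by
  classical
  have hinj := List.inj_on_of_nodup_map hc.edges_nodup
  have hnd : c.darts.Nodup := List.Nodup.of_map _ hc.edges_nodup
  rw [walkFlow, ← List.sum_toFinset _ hnd]
  symm
  refine Finset.sum_of_injOn (fun δ => ⟨δ.edge, δ.edge_mem⟩) ?_ ?_ ?_ ?_
  · intro δ hδ δ' hδ' h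
    exact hinj (by simpa using hδ) (by simpa using hδ') (congrArg Subtype.val h)
  · intro δ _
    simp
  · intro e _ he
    have h0 : ∀ δ ∈ c.darts, δ.edge ≠ e := fun δ hδ h =>
      he ⟨δ, by simpa using hδ, Subtype.ext h⟩
    have h1 : ¬ ∃ δ ∈ c.darts, δ.fst = o.tail e ∧ δ.snd = o.head e := by
      rintro ⟨δ, hδ, h1, h2⟩
      refine h0 δ hδ ?_
      rw [← o.ends e, ← h1, ← h2]; rfl
    have h2 : ¬ ∃ δ ∈ c.darts, δ.fst = o.head e ∧ δ.snd = o.tail e := by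
      rintro ⟨δ, hδ, h1, h2⟩
      refine h0 δ hδ ?_
      rw [← o.ends e, ← h1, ← h2, Sym2.eq_swap]; rfl
    rw [cycleVector, if_neg h1, if_neg h2, zero_mul]
  · intro δ hδ
    have hδ : δ ∈ c.darts := by simpa using hδ
    unfold dartFlow cycleVector
    rcases o.dart_cases δ with ⟨h1, h2⟩ | ⟨h0, h1, h2⟩
    · rw [if_pos h1, if_pos ⟨δ, hδ, h1, h2⟩, one_mul]
    · rw [if_neg h0, if_neg, if_pos ⟨δ, hδ, h1, h2⟩, neg_one_mul]
      rintro ⟨δ', hδ', h1', h2'⟩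
      have : δ' = δ := by
        refine hinj hδ' hδ ?_
        have h := o.ends ⟨δ.edge, δ.edge_mem⟩
        rw [← h1', ← h2'] at h
        exact h
      exact h0 (this ▸ h1')

/-- A path from `b` to `a` through the edge `{a, b}` consists of that edge alone. -/
theorem walkFlow_of_isPath_of_mem_edges (o : Orientation G) (y : G.edgeSet → ℝ) {a b : V}
    (h : G.Adj a b) (w : G.Walk b a) (hw : w.IsPath) (hmem : s(a, b) ∈ w.edges) :
    walkFlow o y w = -dartFlow o y ⟨(a, b), h⟩ := by
  cases w with
  | nil => exact absurd h (G.loopless.irrefl _)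
  | @cons _ c _ h' q =>
    rw [Walk.cons_isPath_iff] at hw
    rw [Walk.edges_cons, List.mem_cons] at hmem
    rcases hmem with hmem | hmem
    · have hca : c = a := by
        rw [Sym2.eq_iff] at hmem
        rcases hmem with ⟨h1, -⟩ | ⟨h1, -⟩
        · exact absurd h1 h.ne
        · exact h1.symm
      subst hca
      have hq : q = Walk.nil := (Walk.isPath_iff_nil.1 hw.1).eq_nil
      have := dartFlow_symm o y ⟨(_, _), h⟩
      simp only [Dart.symm_mk, Prod.swap_prod_mk] at this
      rw [hq, walkFlow_cons, walkFlow_nil, add_zero, this]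
    · exact absurd (Walk.snd_mem_support_of_mem_edges q hmem) hw.2

/-- If `y` sums to zero along all simple cycles, then loops can be cut out of a walk without
changing the sum of `y` along it. -/
theorem walkFlow_bypass (o : Orientation G) (y : G.edgeSet → ℝ)
    (hy : ∀ (a : V) (c : G.Walk a a), c.IsCycle → walkFlow o y c = 0) {a b : V}
    (w : G.Walk a b) : walkFlow o y w.bypass = walkFlow o y w := by
  induction w with
  | nil => simp [Walk.bypass]
  | @cons a c b h w ih =>
    rw [Walk.bypass]
    split_ifs with hs
    · have hsum : walkFlow o y (w.bypass.takeUntil a hs) + walkFlow o y (w.bypass.dropUntil a hs)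
          = walkFlow o y w := by
        rw [← walkFlow_append, Walk.take_spec, ih]
      have hp : (w.bypass.takeUntil a hs).IsPath := (w.bypass_isPath).takeUntil hs
      have hloop : dartFlow o y ⟨(a, c), h⟩ + walkFlow o y (w.bypass.takeUntil a hs) = 0 := by
        by_cases hmem : s(a, c) ∈ (w.bypass.takeUntil a hs).edges
        · rw [walkFlow_of_isPath_of_mem_edges o y h _ hp hmem, add_neg_cancel]
        · rw [← walkFlow_cons]
          exact hy _ _ ((Walk.cons_isCycle_iff _ h).2 ⟨hp, hmem⟩)
      rw [walkFlow_cons]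
      linarith
    · rw [walkFlow_cons, walkFlow_cons, ih]

/-- On a connected graph, an edge vector that sums to zero along all simple cycles has a
potential. -/
theorem exists_gradient_eq (hG : G.Connected) (o : Orientation G) (y : G.edgeSet → ℝ)
    (hy : ∀ (a : V) (c : G.Walk a a), c.IsCycle → walkFlow o y c = 0) :
    ∃ x, gradient o x = y := by
  have hclosed : ∀ (a : V) (c : G.Walk a a), walkFlow o y c = 0 := fun a c => by
    rw [← walkFlow_bypass o y hy, (Walk.isPath_iff_nil.1 c.bypass_isPath).eq_nil, walkFlow_nil]
  obtain ⟨r⟩ := hG.nonempty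
  choose w _ using fun v => (hG.preconnected r v).exists_isPath
  refine ⟨fun v => walkFlow o y (w v), funext fun e => ?_⟩
  have hadj : G.Adj (o.tail e) (o.head e) := by
    rw [← mem_edgeSet, o.ends e]; exact e.2
  have h := hclosed r ((w (o.tail e)).append (Walk.cons hadj (w (o.head e)).reverse))
  have hd : dartFlow o y ⟨(o.tail e, o.head e), hadj⟩ = y e := by
    have : (⟨s(o.tail e, o.head e), hadj⟩ : G.edgeSet) = e := Subtype.ext (o.ends e)
    simp only [dartFlow, Dart.edge_mk, this, if_true]
  rw [walkFlow_append, walkFlow_cons, walkFlow_reverse, hd] at h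
  simp only [gradient]
  linarith

variable [Fintype G.edgeSet] {o : Orientation G} {ι : Type*}

theorem CycleBasis.matrix_mulVec_apply (Sig : CycleBasis o ι) (y : G.edgeSet → ℝ) (k : ι) :
    (Sig.matrix *ᵥ y) k = walkFlow o y (Sig.cycle k) :=
  cycleVector_dotProduct o y (Sig.isCycle k)

theorem CycleBasis.matrix_mulVec_gradient (Sig : CycleBasis o ι) (x : V → ℝ) :
    Sig.matrix *ᵥ gradient o x = 0 := by
  funext k
  rw [Sig.matrix_mulVec_apply, walkFlow_gradient, sub_self, Pi.zero_apply]

/-- The kernel of the cycle-edge incidence matrix consists of potential differences. -/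
theorem CycleBasis.exists_gradient_eq (hG : G.Connected) (Sig : CycleBasis o ι)
    {y : G.edgeSet → ℝ} (hy : Sig.matrix *ᵥ y = 0) : ∃ x, gradient o x = y := by
  refine DroopGrid.exists_gradient_eq hG o y fun a c hc => ?_
  rw [← cycleVector_dotProduct o y hc]
  have hmem : cycleVector o c ∈
      Submodule.span ℝ (Set.range fun k => cycleVector o (Sig.cycle k)) := by
    rw [Sig.span_eq]
    exact Submodule.subset_span ⟨a, c, hc, rfl⟩
  generalize cycleVector o c = w at hmem
  induction hmem using Submodule.span_induction with
  | mem v hv =>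
    obtain ⟨k, rfl⟩ := hv
    exact congrFun hy k
  | zero => exact zero_dotProduct y
  | add v v' _ _ h h' => rw [add_dotProduct, h, h', add_zero]
  | smul r v _ h => rw [smul_dotProduct, h, smul_zero]

end Flow

/-! ### Edge differences of a state -/

section EdgeDiff

variable {V : Type*} {G : SimpleGraph V}

/-- The representative in `(-π, π]` of the angle difference across every edge. -/
noncomputable def edgeDiff (o : Orientation G) (θ : Torus V) : G.edgeSet → ℝ :=
  fun e => (θ (o.head e) - θ (o.tail e)).toReal

/-- The state reached from `θ` by the displacement `x`. -/
noncomputable def shift (θ : Torus V) (x : V → ℝ) : Torus V := fun i => θ i + (x i : Real.Angle)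

theorem continuous_shift (θ : Torus V) : Continuous (shift θ) :=
  continuous_pi fun i =>
    continuous_const.add (Real.Angle.continuous_coe.comp (continuous_apply i))

/-- Edge differences follow a displacement linearly as long as they do not wrap around. -/
theorem edgeDiff_shift [DecidableEq V] (o : Orientation G) (θ : Torus V) (x : V → ℝ)
    (e : G.edgeSet) (h : |edgeDiff o θ e + gradient o x e| < Real.pi) :
    edgeDiff o (shift θ x) e = edgeDiff o θ e + gradient o x e := by
  have hang : shift θ x (o.head e) - shift θ x (o.tail e)
      = ((edgeDiff o θ e + gradient o x e : ℝ) : Real.Angle) := by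
    simp only [shift, gradient, edgeDiff, Real.Angle.coe_add, Real.Angle.coe_sub,
      Real.Angle.coe_toReal]
    abel
  rw [edgeDiff, hang, Real.Angle.toReal_coe_eq_self_iff]
  rw [abs_lt] at h
  exact ⟨h.1, h.2.le⟩

theorem continuousAt_angle_toReal {α : Real.Angle} (h : α ≠ (Real.pi : Real.Angle)) :
    ContinuousAt Real.Angle.toReal α := by
  have : Fact (0 < 2 * Real.pi) := ⟨Real.two_pi_pos⟩
  have hα : α ≠ ((-Real.pi : ℝ) : Real.Angle) := by
    rwa [Real.Angle.coe_neg, Real.Angle.neg_coe_pi]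
  exact continuous_subtype_val.continuousAt.comp
    (AddCircle.continuousAt_equivIoc (2 * Real.pi) (-Real.pi) hα)

theorem abs_toReal_eq_arccos (α : Real.Angle) : |α.toReal| = Real.arccos α.cos := by
  rw [← Real.Angle.cos_toReal, ← Real.cos_abs,
    Real.arccos_cos (abs_nonneg _) (Real.Angle.abs_toReal_le_pi α)]

theorem continuous_abs_edgeDiff (o : Orientation G) (e : G.edgeSet) :
    Continuous fun θ : Torus V => |edgeDiff o θ e| := by
  simp only [edgeDiff, abs_toReal_eq_arccos]
  exact Real.continuous_arccos.comp (Real.Angle.continuous_cos.comp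
    ((continuous_apply _).sub (continuous_apply _)))

theorem continuousAt_edgeDiff (o : Orientation G) {θ : Torus V}
    (h : ∀ e, |edgeDiff o θ e| < Real.pi) : ContinuousAt (edgeDiff o) θ := by
  refine continuousAt_pi.2 fun e => ?_
  have hne : θ (o.head e) - θ (o.tail e) ≠ (Real.pi : Real.Angle) := fun h' => by
    have := h e
    rw [edgeDiff, h', Real.Angle.toReal_pi, abs_of_pos Real.pi_pos] at this
    exact lt_irrefl _ this
  have hc : Continuous fun θ : Torus V => θ (o.head e) - θ (o.tail e) :=
    (continuous_apply _).sub (continuous_apply _)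
  exact ContinuousAt.comp (f := fun θ : Torus V => θ (o.head e) - θ (o.tail e))
    (continuousAt_angle_toReal hne) hc.continuousAt

/-- Away from antipodal neighbours, the counterclockwise distances are the signed edge
differences. -/
theorem dcc_eq_dartFlow [DecidableEq V] (o : Orientation G) {θ : Torus V}
    (h : ∀ e, |edgeDiff o θ e| < Real.pi) (δ : G.Dart) :
    dcc (θ δ.fst) (θ δ.snd) = dartFlow o (edgeDiff o θ) δ := by
  unfold dartFlow dcc
  rcases o.dart_cases δ with ⟨h1, h2⟩ | ⟨h0, h1, h2⟩
  · have hlt := h ⟨δ.edge, δ.edge_mem⟩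
    rw [if_pos h1]
    unfold edgeDiff at hlt ⊢
    rw [← h1, ← h2] at hlt ⊢
    rw [← neg_sub, Real.Angle.toReal_neg_eq_neg_toReal_iff.2, neg_neg]
    intro h'
    rw [h', Real.Angle.toReal_pi, abs_of_pos Real.pi_pos] at hlt
    exact lt_irrefl _ hlt
  · rw [if_neg h0]
    unfold edgeDiff
    rw [← h1, ← h2]

variable [DecidableEq V] [Fintype G.edgeSet] {o : Orientation G} {ι : Type*}

theorem matrix_mulVec_edgeDiff (Sig : CycleBasis o ι) {θ : Torus V}
    (h : ∀ e, |edgeDiff o θ e| < Real.pi) :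
    Sig.matrix *ᵥ edgeDiff o θ = (2 * Real.pi) • windingVector Sig θ := by
  funext k
  rw [Sig.matrix_mulVec_apply, Pi.smul_apply, windingVector, windingNumber, walkFlow, smul_eq_mul,
    ← mul_assoc, mul_one_div_cancel Real.two_pi_pos.ne', one_mul]
  simp only [dcc_eq_dartFlow o h]

theorem windingVector_eq_iff (Sig : CycleBasis o ι) {θ : Torus V} {u : ι → ℝ}
    (h : ∀ e, |edgeDiff o θ e| < Real.pi) :
    windingVector Sig θ = u ↔ Sig.matrix *ᵥ edgeDiff o θ = (2 * Real.pi) • u := by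
  rw [matrix_mulVec_edgeDiff Sig h]
  exact (smul_right_injective _ Real.two_pi_pos.ne').eq_iff.symm

/-! ### Cohesive winding cells -/

/-- In the coordinates `edgeDiff`, the cohesive winding cell is an open box intersected with an
affine subspace. -/
theorem mem_cell_iff (Sig : CycleBasis o ι) (u : ι → ℝ) {γ : G.edgeSet → ℝ}
    (hγ : ∀ e, γ e < Real.pi) (θ : Torus V) :
    θ ∈ windingCell Sig u ∩ cohesiveSet o γ ↔
      Sig.matrix *ᵥ edgeDiff o θ = (2 * Real.pi) • u ∧ ∀ e, |edgeDiff o θ e| < γ e := by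
  constructor
  · rintro ⟨h1, h2⟩
    exact ⟨(windingVector_eq_iff Sig fun e => (h2 e).trans (hγ e)).1 h1, h2⟩
  · rintro ⟨h1, h2⟩
    exact ⟨(windingVector_eq_iff Sig fun e => (h2 e).trans (hγ e)).2 h1, h2⟩

theorem shift_mem_cell (Sig : CycleBasis o ι) {u : ι → ℝ} {γ : G.edgeSet → ℝ}
    (hγ : ∀ e, γ e < Real.pi) {θ : Torus V}
    (hw : Sig.matrix *ᵥ edgeDiff o θ = (2 * Real.pi) • u) {x : V → ℝ}
    (hx : ∀ e, |edgeDiff o θ e + gradient o x e| < γ e) :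
    shift θ x ∈ windingCell Sig u ∩ cohesiveSet o γ := by
  have hd : edgeDiff o (shift θ x) = edgeDiff o θ + gradient o x :=
    funext fun e => edgeDiff_shift o θ x e ((hx e).trans (hγ e))
  rw [mem_cell_iff Sig u hγ, hd]
  refine ⟨?_, hx⟩
  rw [mulVec_add, hw, Sig.matrix_mulVec_gradient, add_zero]

theorem of_mem_closure_cell (Sig : CycleBasis o ι) {u : ι → ℝ} {γ : G.edgeSet → ℝ}
    (hγ : ∀ e, γ e < Real.pi) {θ : Torus V}
    (hθ : θ ∈ closure (windingCell Sig u ∩ cohesiveSet o γ)) :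
    Sig.matrix *ᵥ edgeDiff o θ = (2 * Real.pi) • u ∧ ∀ e, |edgeDiff o θ e| ≤ γ e := by
  have hle : ∀ e, |edgeDiff o θ e| ≤ γ e := fun e =>
    closure_minimal (fun θ' hθ' => (hθ'.2 e).le)
      (isClosed_le (continuous_abs_edgeDiff o e) continuous_const) hθ
  refine ⟨?_, hle⟩
  have : (𝓝[windingCell Sig u ∩ cohesiveSet o γ] θ).NeBot := mem_closure_iff_nhdsWithin_neBot.1 hθ
  have hcont := (continuousAt_edgeDiff o fun e => (hle e).trans_lt (hγ e)).tendsto.mono_left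
    (nhdsWithin_le_nhds (s := windingCell Sig u ∩ cohesiveSet o γ))
  have hlim : Tendsto (fun θ' => Sig.matrix *ᵥ edgeDiff o θ')
      (𝓝[windingCell Sig u ∩ cohesiveSet o γ] θ) (𝓝 (Sig.matrix *ᵥ edgeDiff o θ)) :=
    ((continuous_const.matrix_mulVec continuous_id).tendsto (edgeDiff o θ)).comp hcont
  refine tendsto_nhds_unique hlim (tendsto_const_nhds.congr' ?_)
  filter_upwards [self_mem_nhdsWithin] with θ' hθ'
  exact ((mem_cell_iff Sig u hγ θ').1 hθ').1.symm

/-- If the velocity difference `s` of an edge points inward whenever its coordinate `r` is at an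
end of `[-g, g]`, then small displacements with nearby velocities stay inside. -/
theorem eventually_abs_add_lt {g r s : ℝ} (hg : 0 < g) (hr : |r| ≤ g)
    (hs : ∀ z ∈ ({-1, 1} : Set ℝ), r = z * g → z * s < 0) :
    ∀ᶠ q : ℝ × ℝ in 𝓝[>] (0 : ℝ) ×ˢ 𝓝 s, |r + q.1 * q.2| < g := by
  have hle : 𝓝[>] (0 : ℝ) ×ˢ 𝓝 s ≤ 𝓝 ((0 : ℝ), s) := by
    rw [nhds_prod_eq]
    exact prod_mono nhdsWithin_le_nhds le_rfl
  have hev : ∀ {a b : ℝ}, |a| < b → ∀ᶠ q : ℝ × ℝ in 𝓝[>] (0 : ℝ) ×ˢ 𝓝 s,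
      |a + q.1 * q.2| < b := fun {a b} hab => by
    have hc : Continuous fun q : ℝ × ℝ => |a + q.1 * q.2| := by fun_prop
    exact hle (hc.continuousAt.eventually_lt continuousAt_const (by simpa using hab))
  have hpos : ∀ᶠ q : ℝ × ℝ in 𝓝[>] (0 : ℝ) ×ˢ 𝓝 s, 0 < q.1 :=
    tendsto_fst.eventually self_mem_nhdsWithin
  have hsgn : ∀ z : ℝ, z * s < 0 → ∀ᶠ q : ℝ × ℝ in 𝓝[>] (0 : ℝ) ×ˢ 𝓝 s, z * q.2 < 0 :=
    fun z hz => tendsto_snd.eventually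
      ((continuous_const.mul continuous_id).continuousAt.eventually_lt continuousAt_const hz)
  rcases hr.lt_or_eq with hlt | heq
  · exact hev hlt
  · have hsmall := hev (a := 0) (b := g) (by simpa using hg)
    rcases (abs_eq hg.le).1 heq with h | h
    · filter_upwards [hpos, hsgn 1 (hs 1 (by simp) (by linarith)), hsmall] with q h1 h2 h3
      have := mul_pos h1 (show 0 < -q.2 by linarith)
      rw [abs_lt] at h3 ⊢
      constructor <;> linarith
    · filter_upwards [hpos, hsgn (-1) (hs (-1) (by simp) (by linarith)), hsmall] with q h1 h2 h3
      have := mul_pos h1 (show 0 < q.2 by linarith)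
      rw [abs_lt] at h3 ⊢
      constructor <;> linarith

/-- At a boundary point, an outward velocity must fail to decrease the length of some edge that
is at its bound. -/
theorem exists_face_of_pointsOutward [Finite V] (Sig : CycleBasis o ι) {u : ι → ℝ}
    {γ : G.edgeSet → ℝ} (hγ0 : ∀ e, 0 < γ e) (hγ : ∀ e, γ e < Real.pi) {θ : Torus V}
    (hθ : θ ∈ closure (windingCell Sig u ∩ cohesiveSet o γ)) {v : V → ℝ}
    (hv : PointsOutward (windingCell Sig u ∩ cohesiveSet o γ) θ v) :
    ∃ z ∈ ({-1, 1} : Set ℝ), ∃ e, edgeDiff o θ e = z * γ e ∧ 0 ≤ z * gradient o v e := by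
  obtain ⟨hw, hle⟩ := of_mem_closure_cell Sig hγ hθ
  by_contra! hcon
  refine hv ?_
  have hev : ∀ᶠ q : ℝ × (V → ℝ) in 𝓝[>] (0 : ℝ) ×ˢ 𝓝 v,
      ∀ e, |edgeDiff o θ e + q.1 * gradient o q.2 e| < γ e := by
    refine eventually_all.2 fun e => ?_
    have hc : Continuous fun v : V → ℝ => gradient o v e :=
      (continuous_apply _).sub (continuous_apply _)
    have ht : Tendsto (fun q : ℝ × (V → ℝ) => (q.1, gradient o q.2 e))
        (𝓝[>] (0 : ℝ) ×ˢ 𝓝 v) (𝓝[>] (0 : ℝ) ×ˢ 𝓝 (gradient o v e)) :=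
      tendsto_id.prodMap (hc.tendsto v)
    exact ht.eventually (eventually_abs_add_lt (hγ0 e) (hle e) fun z hz h => hcon z hz e h)
  filter_upwards [hev] with q hq
  rw [not_not]
  refine shift_mem_cell Sig hγ hw (x := fun i => q.1 * q.2 i) fun e => ?_
  have : gradient o (fun i => q.1 * q.2 i) e = q.1 * gradient o q.2 e := (mul_sub _ _ _).symm
  rw [this]
  exact hq e

theorem pointsOutward_of_face (Sig : CycleBasis o ι) {u : ι → ℝ}
    {γ : G.edgeSet → ℝ} (hγ0 : ∀ e, 0 < γ e) (hγ : ∀ e, γ e < Real.pi) {θ : Torus V}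
    {v : V → ℝ} {z : ℝ} (hz : z ∈ ({-1, 1} : Set ℝ)) {e : G.edgeSet}
    (he : edgeDiff o θ e = z * γ e) (hve : 0 ≤ z * gradient o v e) :
    PointsOutward (windingCell Sig u ∩ cohesiveSet o γ) θ v := by
  -- The velocity `v` itself already leads out of the cell for all short times.
  have hev : ∀ᶠ t : ℝ in 𝓝[>] (0 : ℝ),
      shift θ (fun i => t * v i) ∉ windingCell Sig u ∩ cohesiveSet o γ := by
    have hc : Continuous fun t : ℝ => |edgeDiff o θ e + t * gradient o v e| := by fun_prop
    have habs : |edgeDiff o θ e| = γ e := by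
      rcases hz with rfl | rfl <;> simp [he, abs_of_pos (hγ0 e)]
    have hsmall : ∀ᶠ t : ℝ in 𝓝[>] (0 : ℝ), |edgeDiff o θ e + t * gradient o v e| < Real.pi :=
      nhdsWithin_le_nhds (hc.continuousAt.eventually_lt continuousAt_const
        (by simpa [habs] using hγ e))
    filter_upwards [hsmall, self_mem_nhdsWithin] with t ht htpos hmem
    have hg : gradient o (fun i => t * v i) e = t * gradient o v e := (mul_sub _ _ _).symm
    have hlt := ((mem_cell_iff Sig u hγ _).1 hmem).2 e
    rw [edgeDiff_shift o θ _ e (by rwa [hg]), hg, he] at hlt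
    have htv : 0 ≤ t * (z * gradient o v e) := mul_nonneg (le_of_lt htpos) hve
    rw [abs_lt] at hlt
    rcases hz with rfl | rfl <;> linarith [hlt.1, hlt.2]
  have hev' : ∃ᶠ q : ℝ × (V → ℝ) in 𝓝[>] (0 : ℝ) ×ˢ pure v,
      (fun i => θ i + ((q.1 * q.2 i : ℝ) : Real.Angle)) ∉
        windingCell Sig u ∩ cohesiveSet o γ := by
    rw [prod_pure, frequently_map]
    exact hev.frequently
  exact hev'.filter_mono (prod_mono le_rfl (pure_le_nhds v))

/-- If the cell is nonempty, every solution `y` of the closed box constraints and the winding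
constraint is the vector of edge differences of a state in the closure of the cell. -/
theorem exists_mem_closure_cell (hG : G.Connected) (Sig : CycleBasis o ι) {u : ι → ℝ}
    {γ : G.edgeSet → ℝ} (hγ : ∀ e, γ e < Real.pi)
    (hne : (windingCell Sig u ∩ cohesiveSet o γ).Nonempty) {y : G.edgeSet → ℝ}
    (hy : ∀ e, |y e| ≤ γ e) (hw : Sig.matrix *ᵥ y = (2 * Real.pi) • u) :
    ∃ θ ∈ closure (windingCell Sig u ∩ cohesiveSet o γ), edgeDiff o θ = y := by
  obtain ⟨θ₀, h₀⟩ := hne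
  obtain ⟨hw₀, hlt₀⟩ := (mem_cell_iff Sig u hγ θ₀).1 h₀
  obtain ⟨x, hx⟩ := Sig.exists_gradient_eq hG (y := y - edgeDiff o θ₀)
    (by rw [mulVec_sub, hw, hw₀, sub_self])
  have hxe : ∀ e, gradient o x e = y e - edgeDiff o θ₀ e := fun e => congrFun hx e
  refine ⟨shift θ₀ x, ?_, ?_⟩
  · -- The half-open segment from `θ₀` to `shift θ₀ x` lies in the cell.
    have hseg : ∀ s ∈ Set.Ico (0 : ℝ) 1,
        shift θ₀ (s • x) ∈ windingCell Sig u ∩ cohesiveSet o γ := fun s hs => by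
      refine shift_mem_cell Sig hγ hw₀ fun e => ?_
      have hg : gradient o (s • x) e = s * gradient o x e := (mul_sub _ _ _).symm
      have h1 : edgeDiff o θ₀ e + gradient o (s • x) e
          = (1 - s) * edgeDiff o θ₀ e + s * y e := by rw [hg, hxe]; ring
      have hs1 : 0 < 1 - s := sub_pos.2 hs.2
      calc |edgeDiff o θ₀ e + gradient o (s • x) e|
          ≤ |(1 - s) * edgeDiff o θ₀ e| + |s * y e| := h1 ▸ abs_add_le _ _
        _ = (1 - s) * |edgeDiff o θ₀ e| + s * |y e| := by
            rw [abs_mul, abs_mul, abs_of_pos hs1, abs_of_nonneg hs.1]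
        _ < (1 - s) * γ e + s * γ e :=
            add_lt_add_of_lt_of_le (mul_lt_mul_of_pos_left (hlt₀ e) hs1)
              (mul_le_mul_of_nonneg_left (hy e) hs.1)
        _ = γ e := by ring
    have hc : Continuous fun s : ℝ => shift θ₀ (s • x) :=
      (continuous_shift θ₀).comp (continuous_id.smul continuous_const)
    have h1 : (1 : ℝ) ∈ closure (Set.Ico (0 : ℝ) 1) := by
      rw [closure_Ico zero_ne_one]; simp
    have := map_mem_closure hc h1 hseg
    simpa using this
  · funext e
    have hsum : edgeDiff o θ₀ e + gradient o x e = y e := by rw [hxe]; ring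
    rw [edgeDiff_shift o θ₀ x e (by rw [hsum]; exact (hy e).trans_lt (hγ e)), hsum]

end EdgeDiff

/-! ### Comparison of the optimization problems -/

section Values

variable {V : Type*} [Fintype V] [DecidableEq V] {G : SimpleGraph V} [DecidableRel G.Adj]
  {o : Orientation G} {ι : Type*}

theorem vectorField_eq (o : Orientation G) (P : Params G) (θ : Torus V) :
    vectorField o P θ = netInjection o P fun e => Real.sin (edgeDiff o θ e) := by
  simp only [vectorField, edgeDiff, Real.Angle.sin_toReal]

theorem relaxationValue_le_transcriptionValue (Sig : CycleBasis o ι) (P : Params G) (u : ι → ℝ)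
    (γ : G.edgeSet → ℝ) (Q : G.edgeSet → Set (ℝ × ℝ)) (hQ : ∀ e, IsSineRelaxation (γ e) (Q e)) :
    relaxationValue Sig P u γ Q ≤ transcriptionValue Sig P u γ := by
  refine le_iInf fun x => ?_
  obtain ⟨x, hx⟩ := x
  obtain ⟨z, hz, e, hface⟩ := hx.outward
  refine (iInf₂_le z hz).trans ((iInf_le _ e).trans ?_)
  have hfeas : RelaxationFeasible Sig P u γ Q z e x :=
    { f_eq := hx.f_eq
      mem_polytope := fun e' => by
        rw [hx.η_eq e']
        exact (hQ e').graph_subset _ (abs_le.1 (hx.y_le e'))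
      winding := hx.winding
      outward := hface }
  exact iInf_le (fun x : {x // RelaxationFeasible Sig P u γ Q z e x} =>
    (P.deviation x.1.2.2 : EReal)) ⟨x, hfeas⟩

theorem transcriptionValue_le_minMaxDeviation (Sig : CycleBasis o ι) (P : Params G) (u : ι → ℝ)
    (γ : G.edgeSet → ℝ) (hγ0 : ∀ e, 0 < γ e) (hγ : ∀ e, γ e < Real.pi) :
    transcriptionValue Sig P u γ ≤
      minMaxDeviation o P (windingCell Sig u ∩ cohesiveSet o γ) := by
  refine le_iInf fun θ => ?_
  obtain ⟨θ, hfr, hout⟩ := θ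
  obtain ⟨hw, hle⟩ := of_mem_closure_cell Sig hγ hfr.1
  have hfeas : TranscriptionFeasible Sig P u γ
      (edgeDiff o θ, fun e => Real.sin (edgeDiff o θ e), vectorField o P θ) :=
    { f_eq := vectorField_eq o P θ
      η_eq := fun _ => rfl
      y_le := hle
      winding := hw
      outward := exists_face_of_pointsOutward Sig hγ0 hγ hfr.1 hout }
  exact iInf_le (fun x : {x // TranscriptionFeasible Sig P u γ x} =>
    (P.deviation x.1.2.2 : EReal)) ⟨_, hfeas⟩

theorem minMaxDeviation_le_transcriptionValue (hG : G.Connected) (Sig : CycleBasis o ι)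
    (P : Params G) (u : ι → ℝ) (γ : G.edgeSet → ℝ) (hγ0 : ∀ e, 0 < γ e)
    (hγ : ∀ e, γ e < Real.pi) (hne : (windingCell Sig u ∩ cohesiveSet o γ).Nonempty) :
    minMaxDeviation o P (windingCell Sig u ∩ cohesiveSet o γ) ≤
      transcriptionValue Sig P u γ := by
  refine le_iInf fun x => ?_
  obtain ⟨⟨y, η, f⟩, hx⟩ := x
  obtain ⟨θ, hcl, rfl⟩ := exists_mem_closure_cell hG Sig hγ hne hx.y_le hx.winding
  obtain rfl : η = fun e => Real.sin (edgeDiff o θ e) := funext hx.η_eq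
  obtain rfl : f = vectorField o P θ := hx.f_eq.trans (vectorField_eq o P θ).symm
  obtain ⟨z, hz, e, he, hve⟩ := hx.outward
  have hnot : θ ∉ windingCell Sig u ∩ cohesiveSet o γ := fun hmem => by
    have hlt := ((mem_cell_iff Sig u hγ θ).1 hmem).2 e
    have he' : edgeDiff o θ e = z * γ e := he
    rcases hz with rfl | rfl <;> simp [he', abs_of_pos (hγ0 e)] at hlt
  exact iInf_le (fun θ : {θ : Torus V // θ ∈ frontier (windingCell Sig u ∩ cohesiveSet o γ) ∧
      PointsOutward (windingCell Sig u ∩ cohesiveSet o γ) θ (P.freq (vectorField o P θ))} =>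
    (maxFreqDeviation o P θ.1 : EReal))
    ⟨θ, ⟨hcl, fun hint => hnot (interior_subset hint)⟩,
      pointsOutward_of_face Sig hγ0 hγ hz he hve⟩

end Values

end DroopGrid

theorem lemma2 {V : Type*} [Fintype V] [DecidableEq V] (G : SimpleGraph V) [DecidableRel G.Adj]
    (hG : G.Connected) (o : DroopGrid.Orientation G) {ι : Type*} (Sig : DroopGrid.CycleBasis o ι)
    (P : DroopGrid.Params G)
    (u : ι → ℝ) (hu : u ∈ Set.range (DroopGrid.windingVector Sig))
    (γ : G.edgeSet → ℝ) (hγ : ∀ e, γ e ∈ Set.Ioc 0 (Real.pi / 2))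
    (Q : G.edgeSet → Set (ℝ × ℝ)) (hQ : ∀ e, DroopGrid.IsSineRelaxation (γ e) (Q e))
    (S : Set (DroopGrid.Torus V))
    (hS : S = DroopGrid.windingCell Sig u ∩ DroopGrid.cohesiveSet o γ) :
    DroopGrid.relaxationValue Sig P u γ Q ≤ DroopGrid.transcriptionValue Sig P u γ ∧
      (S.Nonempty →
        DroopGrid.transcriptionValue Sig P u γ = DroopGrid.minMaxDeviation o P S) := by
  have hγ0 : ∀ e, 0 < γ e := fun e => (hγ e).1
  have hγπ : ∀ e, γ e < Real.pi := fun e => (hγ e).2.trans_lt (half_lt_self Real.pi_pos)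
  refine ⟨DroopGrid.relaxationValue_le_transcriptionValue Sig P u γ Q hQ, ?_⟩
  rintro hne
  subst hS
  exact le_antisymm
    (DroopGrid.transcriptionValue_le_minMaxDeviation Sig P u γ hγ0 hγπ)
    (DroopGrid.minMaxDeviation_le_transcriptionValue hG Sig P u γ hγ0 hγπ hne)
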